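/- Let $M$ be a smooth manifold (Hausdorff, second countable, without boundary), let $h$ be a smooth nondegenerate metric on $M$, i.e. a smooth field of symmetric nondegenerate bilinear forms on the tangent spaces (of arbitrary signature), and let $\nabla$ be its Levi-Civita connection. For a smooth $(1,1)$-tensor field $\varphi$ put $(\nabla_X\varphi)Y=\nabla_X(\varphi Y)-\varphi(\nabla_XY)$ and $$\mathcal N_\varphi(X,Y)=\varphi^2[X,Y]+[\varphi X,\varphi Y]-\varphi[\varphi X,Y]-\varphi[X,\varphi Y];$$ $\varphi$ is called parallel if $\nabla\varphi=0$, and integrable if $\mathcal N_\varphi=0$. A. Let $(M,h,P)$ be an almost para-Hermitian manifold, that is, $P$ is a smooth $(1,1)$-tensor field with $P^2=I$ and $h(PX,Y)=h(X,\widehat PY)$ for all $X,Y$, where $\widehat P=-P$. Let $\Omega_P(X,Y)=h(PX,Y)$ be its fundamental 2-form. Then $\nabla P=0$ if and only if $(M,h,P)$ is para-Kähler, i.e. $\mathcal N_P=0$ and $d\Omega_P=0$. B. Let $(M,h,G)$ be an almost golden-Hermitian manifold, that is, $G$ is a smooth $(1,1)$-tensor field with $G^2=G+I$ and $h(GX,Y)=h(X,\widehat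 GY)$ for all $X,Y$, where $\widehat G=I-G$. Let $\mathcal R=P_G=\frac1{\sqrt5}(2G-I)$ be the associated almost product structure and $\Omega_{\mathcal R}(X,Y)=h(\mathcal RX,Y)$. Then $\nabla G=0$ if and only if $(M,h,G)$ is golden-Kähler, i.e. $\mathcal N_G=0$ and $d\Omega_{\mathcal R}=0$. -/

import Mathlib

open Bundle VectorField
open scoped Manifold ContDiff

noncomputable section

section Geometry

variable {E : Type*} [NormedAddCommGroup E] [NormedSpace ℝ E]
  {H : Type*} [TopologicalSpace H] (I : ModelWithCorners ℝ E H)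
  (M : Type*) [TopologicalSpace M] [ChartedSpace H M]

/-- A smooth nondegenerate metric: a smooth field of symmetric nondegenerate bilinear forms on the
tangent spaces, of arbitrary signature. -/
structure NondegenerateMetric [IsManifold I ∞ M] where
  toFun (x : M) : TangentSpace I x →L[ℝ] TangentSpace I x →L[ℝ] ℝ
  symm (x : M) (v w : TangentSpace I x) : toFun x v w = toFun x w v
  nondegenerate (x : M) (v : TangentSpace I x) (hv : ∀ w, toFun x v w = 0) : v = 0
  contMDiff : ContMDiff I (I.prod 𝓘(ℝ, E →L[ℝ] E →L[ℝ] ℝ)) ∞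
    (fun x ↦ TotalSpace.mk' (E →L[ℝ] E →L[ℝ] ℝ)
      (E := fun x : M ↦ TangentSpace I x →L[ℝ] TangentSpace I x →L[ℝ] ℝ) x (toFun x))

variable {I M} [IsManifold I ∞ M]

instance : CoeFun (NondegenerateMetric I M)
    fun _ ↦ (x : M) → TangentSpace I x →L[ℝ] TangentSpace I x →L[ℝ] ℝ :=
  ⟨NondegenerateMetric.toFun⟩

namespace NondegenerateMetric

variable (h : NondegenerateMetric I M)

/-- The right-hand side of the Koszul formula for `2 h(∇_X Y, Z)`. -/
def koszul (X Y Z : Π x : M, TangentSpace I x) (x : M) : ℝ :=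
  d% (fun y ↦ h y (Y y) (Z y)) x (X x) + d% (fun y ↦ h y (X y) (Z y)) x (Y x)
    - d% (fun y ↦ h y (X y) (Y y)) x (Z x)
    + h x (mlieBracket I X Y x) (Z x) - h x (mlieBracket I X Z x) (Y x)
    - h x (mlieBracket I Y Z x) (X x)

variable {h} in
theorem mdifferentiableAt_apply {X Y : Π x : M, TangentSpace I x} {x : M}
    (hX : MDiffAt (T% X) x) (hY : MDiffAt (T% Y) x) :
    MDiffAt (fun y ↦ h y (X y) (Y y)) x := by
  have : MDifferentiableAt I (I.prod 𝓘(ℝ))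
      (fun m ↦ TotalSpace.mk' ℝ (E := Bundle.Trivial M ℝ) m (h m (X m) (Y m))) x := by
    apply MDifferentiableAt.clm_bundle_apply₂ (F₁ := E) (F₂ := E)
    · exact h.contMDiff.mdifferentiableAt (by simp)
    · exact hX
    · exact hY
  simp only [mdifferentiableAt_totalSpace] at this
  exact this.2

variable [FiniteDimensional ℝ E]

theorem tensorialAt_koszul_left {Y Z : Π x : M, TangentSpace I x} {x : M}
    (hY : MDiffAt (T% Y) x) (hZ : MDiffAt (T% Z) x) :
    TensorialAt I E (fun X ↦ h.koszul X Y Z x) x where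
  smul {f X} hf hX := by
    have := FiniteDimensional.complete ℝ E
    have e1 : (fun y ↦ h y ((f • X) y) (Z y)) = f * (fun y ↦ h y (X y) (Z y)) := by
      ext y; simp
    have e2 : (fun y ↦ h y ((f • X) y) (Y y)) = f * (fun y ↦ h y (X y) (Y y)) := by
      ext y; simp
    simp only [koszul, e1, e2, mvfderiv_mul hf (mdifferentiableAt_apply hX hZ),
      mvfderiv_mul hf (mdifferentiableAt_apply hX hY), mlieBracket_smul_left hf hX]
    simp
    ring
  add {X X'} hX hX' := by
    have := FiniteDimensional.complete ℝ E
    have e1 : (fun y ↦ h y ((X + X') y) (Z y)) =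
        (fun y ↦ h y (X y) (Z y)) + (fun y ↦ h y (X' y) (Z y)) := by
      ext y; simp
    have e2 : (fun y ↦ h y ((X + X') y) (Y y)) =
        (fun y ↦ h y (X y) (Y y)) + (fun y ↦ h y (X' y) (Y y)) := by
      ext y; simp
    simp only [koszul, e1, e2,
      mvfderiv_add (mdifferentiableAt_apply hX hZ) (mdifferentiableAt_apply hX' hZ),
      mvfderiv_add (mdifferentiableAt_apply hX hY) (mdifferentiableAt_apply hX' hY),
      mlieBracket_add_left hX hX']
    simp
    ring

theorem tensorialAt_koszul_right {X Y : Π x : M, TangentSpace I x} {x : M}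
    (hX : MDiffAt (T% X) x) (hY : MDiffAt (T% Y) x) :
    TensorialAt I E (fun Z ↦ h.koszul X Y Z x) x where
  smul {f Z} hf hZ := by
    have := FiniteDimensional.complete ℝ E
    have e (W : Π x : M, TangentSpace I x) :
        (fun y ↦ h y (W y) ((f • Z) y)) = f * (fun y ↦ h y (W y) (Z y)) := by
      ext y; simp
    simp only [koszul, e, mvfderiv_mul hf (mdifferentiableAt_apply hX hZ),
      mvfderiv_mul hf (mdifferentiableAt_apply hY hZ), mlieBracket_smul_right hf hZ]
    simp [h.symm x (Z x)]
    ring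
  add {Z Z'} hZ hZ' := by
    have := FiniteDimensional.complete ℝ E
    have e (W : Π x : M, TangentSpace I x) : (fun y ↦ h y (W y) ((Z + Z') y)) =
        (fun y ↦ h y (W y) (Z y)) + (fun y ↦ h y (W y) (Z' y)) := by
      ext y; simp
    simp only [koszul, e,
      mvfderiv_add (mdifferentiableAt_apply hX hZ) (mdifferentiableAt_apply hX hZ'),
      mvfderiv_add (mdifferentiableAt_apply hY hZ) (mdifferentiableAt_apply hY hZ'),
      mlieBracket_add_right hZ hZ']
    simp
    ring

/-- For `Y` differentiable at `x`, the bilinear form `(u, w) ↦ 2 h(∇_u Y, w)` on `T_x M`. -/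
def koszulForm (Y : Π x : M, TangentSpace I x) (x : M) (hY : MDiffAt (T% Y) x) :
    TangentSpace I x →L[ℝ] TangentSpace I x →L[ℝ] ℝ :=
  TensorialAt.mkHom₂ (fun X Z ↦ h.koszul X Y Z x) x
    (fun _ hZ ↦ h.tensorialAt_koszul_left hY hZ) (fun _ hX ↦ h.tensorialAt_koszul_right hX hY)

theorem koszulForm_apply {X Y Z : Π x : M, TangentSpace I x} {x : M}
    (hX : MDiffAt (T% X) x) (hY : MDiffAt (T% Y) x) (hZ : MDiffAt (T% Z) x) :
    h.koszulForm Y x hY (X x) (Z x) = h.koszul X Y Z x :=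
  TensorialAt.mkHom₂_apply _ _ hX hZ

theorem bijective_flat (x : M) : Function.Bijective (h x) := by
  have : FiniteDimensional ℝ (TangentSpace I x) := inferInstanceAs (FiniteDimensional ℝ E)
  have : T2Space (TangentSpace I x) := inferInstanceAs (T2Space E)
  let e := LinearMap.toContinuousLinearMap (𝕜 := ℝ) (E := TangentSpace I x) (F' := ℝ)
  let f : TangentSpace I x →ₗ[ℝ] Module.Dual ℝ (TangentSpace I x) :=
    e.symm.toLinearMap ∘ₗ (h x).toLinearMap
  have hinj : Function.Injective f := by
    rw [← LinearMap.ker_eq_bot, LinearMap.ker_eq_bot']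
    intro v hv
    exact h.nondegenerate x v fun w ↦ congr($hv w)
  have hf : Function.Bijective f :=
    ⟨hinj, (LinearMap.injective_iff_surjective_of_finrank_eq_finrank
      Subspace.dual_finrank_eq.symm).1 hinj⟩
  have : (h x : TangentSpace I x → TangentSpace I x →L[ℝ] ℝ) = e ∘ f := by
    ext v w
    rfl
  rw [this]
  exact e.bijective.comp hf

/-- The vector corresponding to a covector under the metric: `h x (sharp x ξ) = ξ`. -/
def sharp (x : M) : (TangentSpace I x →L[ℝ] ℝ) →ₗ[ℝ] TangentSpace I x :=
  (LinearEquiv.ofBijective (h x).toLinearMap (h.bijective_flat x)).symm.toLinearMap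

theorem apply_sharp (x : M) (ξ : TangentSpace I x →L[ℝ] ℝ) : h x (h.sharp x ξ) = ξ :=
  (LinearEquiv.ofBijective (h x).toLinearMap (h.bijective_flat x)).apply_symm_apply ξ

open Classical in
/-- The underlying function of the Levi-Civita connection: at a point where `Y` is differentiable,
`∇_u Y` is the vector determined by the Koszul formula. -/
def leviCivitaFun (Y : Π x : M, TangentSpace I x) (x : M) :
    TangentSpace I x →L[ℝ] TangentSpace I x :=
  have : FiniteDimensional ℝ (TangentSpace I x) := inferInstanceAs (FiniteDimensional ℝ E)
  have : T2Space (TangentSpace I x) := inferInstanceAs (T2Space E)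
  if hY : MDiffAt (T% Y) x then
    LinearMap.toContinuousLinearMap
      ((1 / 2 : ℝ) • (h.sharp x ∘ₗ (h.koszulForm Y x hY).toLinearMap))
  else 0

theorem two_mul_leviCivitaFun {X Y Z : Π x : M, TangentSpace I x} {x : M}
    (hX : MDiffAt (T% X) x) (hY : MDiffAt (T% Y) x) (hZ : MDiffAt (T% Z) x) :
    2 * h x (h.leviCivitaFun Y x (X x)) (Z x) = h.koszul X Y Z x := by
  rw [← h.koszulForm_apply hX hY hZ]
  simp [leviCivitaFun, hY, apply_sharp]

theorem eq_leviCivitaFun {Y : Π x : M, TangentSpace I x} {x : M} (hY : MDiffAt (T% Y) x)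
    (A : TangentSpace I x →L[ℝ] TangentSpace I x)
    (hA : ∀ X Z : Π x : M, TangentSpace I x, MDiffAt (T% X) x → MDiffAt (T% Z) x →
      2 * h x (A (X x)) (Z x) = h.koszul X Y Z x) : h.leviCivitaFun Y x = A := by
  ext u
  rw [← sub_eq_zero]
  refine h.nondegenerate x _ fun w ↦ ?_
  have hu := FiberBundle.mdifferentiableAt_extend I E u
  have hw := FiberBundle.mdifferentiableAt_extend I E w
  have h1 := h.two_mul_leviCivitaFun hu hY hw
  rw [← hA _ _ hu hw] at h1
  simp only [FiberBundle.extend_apply_self] at h1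
  simp only [map_sub, sub_apply]
  linarith

/-- The Levi-Civita connection of a nondegenerate metric. -/
def leviCivita : CovariantDerivative I E (TangentSpace I : M → Type _) where
  toFun := h.leviCivitaFun
  isCovariantDerivativeOnUniv :=
    { add := by
        intro Y Y' x hY hY' _
        have := FiniteDimensional.complete ℝ E
        refine h.eq_leviCivitaFun (mdifferentiableAt_add_section hY hY') _ fun X Z hX hZ ↦ ?_
        have e1 : (fun y ↦ h y ((Y + Y') y) (Z y)) =
            (fun y ↦ h y (Y y) (Z y)) + (fun y ↦ h y (Y' y) (Z y)) := by
          ext y; simp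
        have e2 : (fun y ↦ h y (X y) ((Y + Y') y)) =
            (fun y ↦ h y (X y) (Y y)) + (fun y ↦ h y (X y) (Y' y)) := by
          ext y; simp
        have h1 := h.two_mul_leviCivitaFun hX hY hZ
        have h2 := h.two_mul_leviCivitaFun hX hY' hZ
        simp only [koszul, e1, e2,
          mvfderiv_add (mdifferentiableAt_apply hX hY) (mdifferentiableAt_apply hX hY'),
          mvfderiv_add (mdifferentiableAt_apply hY hZ) (mdifferentiableAt_apply hY' hZ),
          mlieBracket_add_right hY hY', mlieBracket_add_left hY hY'] at h1 h2 ⊢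
        simp at h1 h2 ⊢
        linarith
      leibniz := by
        intro Y f x hY hf _
        have := FiniteDimensional.complete ℝ E
        refine h.eq_leviCivitaFun (hf.smul_section hY) _ fun X Z hX hZ ↦ ?_
        have e1 : (fun y ↦ h y ((f • Y) y) (Z y)) = f * (fun y ↦ h y (Y y) (Z y)) := by
          ext y; simp
        have e2 : (fun y ↦ h y (X y) ((f • Y) y)) = f * (fun y ↦ h y (X y) (Y y)) := by
          ext y; simp
        have h1 := h.two_mul_leviCivitaFun hX hY hZ
        simp only [koszul, e1, e2, mvfderiv_mul hf (mdifferentiableAt_apply hX hY),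
          mvfderiv_mul hf (mdifferentiableAt_apply hY hZ),
          mlieBracket_smul_right hf hY, mlieBracket_smul_left hf hY] at h1 ⊢
        simp [h.symm x (Y x)] at h1 ⊢
        linear_combination f x * h1 }

/-- `∇` is torsion-free and compatible with the metric. -/
structure IsLeviCivita (cov : CovariantDerivative I E (TangentSpace I : M → Type _)) : Prop where
  torsion_free {X Y : Π x : M, TangentSpace I x} {x : M} (hX : MDiffAt (T% X) x)
    (hY : MDiffAt (T% Y) x) : cov Y x (X x) - cov X x (Y x) = mlieBracket I X Y x
  metric {X Y Z : Π x : M, TangentSpace I x} {x : M} (hY : MDiffAt (T% Y) x)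
    (hZ : MDiffAt (T% Z) x) : d% (fun y ↦ h y (Y y) (Z y)) x (X x) =
      h x (cov Y x (X x)) (Z x) + h x (Y x) (cov Z x (X x))

theorem isLeviCivita_leviCivita : h.IsLeviCivita h.leviCivita where
  torsion_free {X Y x} hX hY := by
    rw [← sub_eq_zero]
    refine h.nondegenerate x _ fun w ↦ ?_
    have hw := FiberBundle.mdifferentiableAt_extend I E w
    have h1 := h.two_mul_leviCivitaFun hX hY hw
    have h2 := h.two_mul_leviCivitaFun hY hX hw
    have e (V W : Π x : M, TangentSpace I x) :
      (fun y ↦ h y (V y) (W y)) = fun y ↦ h y (W y) (V y) := by ext y; exact h.symm ..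
    simp only [koszul, FiberBundle.extend_apply_self, e Y X, mlieBracket_swap_apply (V := Y)
      (W := X)] at h1 h2
    simp [leviCivita] at h1 h2 ⊢
    linarith
  metric {X Y Z x} hY hZ := by
    have e (V W : Π x : M, TangentSpace I x) :
      (fun y ↦ h y (V y) (W y)) = fun y ↦ h y (W y) (V y) := by ext y; exact h.symm ..
    have hX := FiberBundle.mdifferentiableAt_extend I E (X x)
    set X' := FiberBundle.extend E (X x) with hX'
    have hx : X x = X' x := by simp [hX']
    rw [hx]
    have h1 := h.two_mul_leviCivitaFun hX hY hZ
    have h2 := h.two_mul_leviCivitaFun hX hZ hY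
    simp only [koszul, e Z Y, mlieBracket_swap_apply (V := Z)
      (W := Y)] at h1 h2
    rw [h.symm x (Y x)]
    simp [leviCivita] at h1 h2 ⊢
    linarith

/-- The Levi-Civita connection is the only torsion-free metric connection (connections are compared
on differentiable vector fields, as their values on other fields carry no information). -/
theorem IsLeviCivita.eq {cov : CovariantDerivative I E (TangentSpace I : M → Type _)}
    (hcov : h.IsLeviCivita cov) {Y : Π x : M, TangentSpace I x} {x : M} (hY : MDiffAt (T% Y) x) :
    cov Y x = h.leviCivita Y x := by
  refine (h.eq_leviCivitaFun hY _ fun X Z hX hZ ↦ ?_).symm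
  rw [koszul, hcov.metric hY hZ, hcov.metric hX hZ, hcov.metric hX hY,
    ← hcov.torsion_free hX hY, ← hcov.torsion_free hX hZ, ← hcov.torsion_free hY hZ]
  simp only [map_sub, sub_apply]
  rw [h.symm x (X x), h.symm x (Y x), h.symm x (cov Z x (X x)), h.symm x (cov X x (Z x)),
    h.symm x (cov Y x (Z x))]
  ring_nf

end NondegenerateMetric

/-! ### Tensor fields of type `(1,1)`, acting on vector fields by `(φ X) y = φ y (X y)` -/

/-- Smoothness of a field of endomorphisms of the tangent spaces. -/
def IsSmoothEndField (φ : Π x : M, TangentSpace I x →L[ℝ] TangentSpace I x) : Prop :=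
  ContMDiff I (I.prod 𝓘(ℝ, E →L[ℝ] E)) ∞
    (fun x ↦ TotalSpace.mk' (E →L[ℝ] E)
      (E := fun x : M ↦ TangentSpace I x →L[ℝ] TangentSpace I x) x (φ x))

/-- `P` is an almost product structure: a smooth `(1,1)`-tensor field with `P² = I`. -/
structure IsAlmostProduct (P : Π x : M, TangentSpace I x →L[ℝ] TangentSpace I x) : Prop where
  smooth : IsSmoothEndField P
  sq (x : M) (v : TangentSpace I x) : P x (P x v) = v

/-- `G` is an almost golden structure: a smooth `(1,1)`-tensor field with `G² = G + I`. -/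
structure IsAlmostGolden (G : Π x : M, TangentSpace I x →L[ℝ] TangentSpace I x) : Prop where
  smooth : IsSmoothEndField G
  sq (x : M) (v : TangentSpace I x) : G x (G x v) = G x v + v

/-- The conjugate `-P` of an almost product structure. -/
def conjProduct (P : Π x : M, TangentSpace I x →L[ℝ] TangentSpace I x) (x : M) :
    TangentSpace I x →L[ℝ] TangentSpace I x := -P x

/-- The conjugate `I - G` of an almost golden structure. -/
def conjGolden (G : Π x : M, TangentSpace I x →L[ℝ] TangentSpace I x) (x : M) :
    TangentSpace I x →L[ℝ] TangentSpace I x := ContinuousLinearMap.id ℝ _ - G x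

/-- The almost product structure `(2G - I) / √5` associated with an almost golden structure. -/
def associatedProduct (G : Π x : M, TangentSpace I x →L[ℝ] TangentSpace I x) (x : M) :
    TangentSpace I x →L[ℝ] TangentSpace I x :=
  (1 / √5 : ℝ) • ((2 : ℝ) • G x - ContinuousLinearMap.id ℝ _)

/-- `(M, h, P)` is an almost para-Hermitian manifold: `P` is an almost product structure with
`h(PX, Y) = h(X, P̂Y)`, where `P̂ = -P`. -/
structure IsAlmostParaHermitian (h : NondegenerateMetric I M)
    (P : Π x : M, TangentSpace I x →L[ℝ] TangentSpace I x) : Prop extends IsAlmostProduct P where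
  hyperbolic (x : M) (v w : TangentSpace I x) : h x (P x v) w = h x v (conjProduct P x w)

/-- `(M, h, G)` is an almost golden-Hermitian manifold: `G` is an almost golden structure with
`h(GX, Y) = h(X, ĜY)`, where `Ĝ = I - G`. -/
structure IsAlmostGoldenHermitian (h : NondegenerateMetric I M)
    (G : Π x : M, TangentSpace I x →L[ℝ] TangentSpace I x) : Prop extends IsAlmostGolden G where
  hyperbolic (x : M) (v w : TangentSpace I x) : h x (G x v) w = h x v (conjGolden G x w)

/-- The Nijenhuis tensor `φ²[X, Y] + [φX, φY] - φ[φX, Y] - φ[X, φY]` on vector fields. -/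
def nijenhuis (φ : Π x : M, TangentSpace I x →L[ℝ] TangentSpace I x)
    (X Y : Π x : M, TangentSpace I x) (x : M) : TangentSpace I x :=
  φ x (φ x (mlieBracket I X Y x))
    + mlieBracket I (fun y ↦ φ y (X y)) (fun y ↦ φ y (Y y)) x
    - φ x (mlieBracket I (fun y ↦ φ y (X y)) Y x)
    - φ x (mlieBracket I X (fun y ↦ φ y (Y y)) x)

/-- `φ` is integrable: its Nijenhuis tensor vanishes on all smooth vector fields. -/
def IsIntegrable (φ : Π x : M, TangentSpace I x →L[ℝ] TangentSpace I x) : Prop :=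
  ∀ X Y : Π x : M, TangentSpace I x, CMDiff ∞ (T% X) → CMDiff ∞ (T% Y) →
    ∀ x, nijenhuis φ X Y x = 0

/-- The exterior differential of a 2-form `α`, evaluated on vector fields. -/
def extDerivTwo (α : Π x : M, TangentSpace I x →L[ℝ] TangentSpace I x →L[ℝ] ℝ)
    (X Y Z : Π x : M, TangentSpace I x) (x : M) : ℝ :=
  d% (fun y ↦ α y (Y y) (Z y)) x (X x) - d% (fun y ↦ α y (X y) (Z y)) x (Y x)
    + d% (fun y ↦ α y (X y) (Y y)) x (Z x)
    - α x (mlieBracket I X Y x) (Z x) - α x (mlieBracket I Y Z x) (X x)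
    + α x (mlieBracket I X Z x) (Y x)

/-- `dα = 0`: the exterior differential of `α` vanishes on all smooth vector fields. -/
def IsClosedTwoForm (α : Π x : M, TangentSpace I x →L[ℝ] TangentSpace I x →L[ℝ] ℝ) : Prop :=
  ∀ X Y Z : Π x : M, TangentSpace I x, CMDiff ∞ (T% X) → CMDiff ∞ (T% Y) → CMDiff ∞ (T% Z) →
    ∀ x, extDerivTwo α X Y Z x = 0

/-- The fundamental 2-form `Ω_P(X, Y) = h(PX, Y)`. -/
def fundamentalForm (h : NondegenerateMetric I M)
    (P : Π x : M, TangentSpace I x →L[ℝ] TangentSpace I x) (x : M) :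
    TangentSpace I x →L[ℝ] TangentSpace I x →L[ℝ] ℝ := (h x).comp (P x)

/-- `(M, h, P)` is para-Kähler: almost para-Hermitian with `dΩ_P = 0` and `P` integrable. -/
structure IsParaKaehler (h : NondegenerateMetric I M)
    (P : Π x : M, TangentSpace I x →L[ℝ] TangentSpace I x) : Prop
    extends IsAlmostParaHermitian h P where
  closed : IsClosedTwoForm (fundamentalForm h P)
  integrable : IsIntegrable P

/-- `(M, h, G)` is golden-Kähler: almost golden-Hermitian with `dΩ_R = 0` for the associated almost
product structure `R = (2G - I) / √5`, and `G` integrable. -/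
structure IsGoldenKaehler (h : NondegenerateMetric I M)
    (G : Π x : M, TangentSpace I x →L[ℝ] TangentSpace I x) : Prop
    extends IsAlmostGoldenHermitian h G where
  closed : IsClosedTwoForm (fundamentalForm h (associatedProduct G))
  integrable : IsIntegrable G

/-- `∇φ = 0`: the covariant derivative `(∇_X φ)Y = ∇_X(φY) - φ(∇_X Y)` vanishes for all smooth
vector fields. -/
def IsParallel (cov : CovariantDerivative I E (TangentSpace I : M → Type _))
    (φ : Π x : M, TangentSpace I x →L[ℝ] TangentSpace I x) : Prop :=
  ∀ X Y : Π x : M, TangentSpace I x, CMDiff ∞ (T% X) → CMDiff ∞ (T% Y) →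
    ∀ x, cov (fun y ↦ φ y (Y y)) x (X x) - φ x (cov Y x (X x)) = 0

end Geometry

end

open Bundle VectorField
open scoped Manifold ContDiff

section ParallelStructures

variable {E : Type*} [NormedAddCommGroup E] [NormedSpace ℝ E]
  {H : Type*} [TopologicalSpace H] {I : ModelWithCorners ℝ E H}
  {M : Type*} [TopologicalSpace M] [ChartedSpace H M] [IsManifold I ∞ M]

theorem IsSmoothEndField.contMDiff_apply {φ : Π x : M, TangentSpace I x →L[ℝ] TangentSpace I x}
    (hφ : IsSmoothEndField φ) {X : Π x : M, TangentSpace I x} (hX : CMDiff ∞ (T% X)) :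
    CMDiff ∞ (T% (fun y ↦ φ y (X y))) :=
  ContMDiff.clm_bundle_apply (F₁ := E) (F₂ := E) hφ hX

/-- `(∇_u φ)Y = ∇_u (φ Y) - φ (∇_u Y)` for a tangent vector `u` at `x`. -/
noncomputable def covDerivEnd (cov : CovariantDerivative I E (TangentSpace I : M → Type _))
    (φ : Π x : M, TangentSpace I x →L[ℝ] TangentSpace I x) (Y : Π x : M, TangentSpace I x)
    (x : M) : TangentSpace I x →L[ℝ] TangentSpace I x :=
  cov (fun y ↦ φ y (Y y)) x - φ x ∘L cov Y x

theorem covDerivEnd_apply (cov : CovariantDerivative I E (TangentSpace I : M → Type _))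
    (φ : Π x : M, TangentSpace I x →L[ℝ] TangentSpace I x) (Y : Π x : M, TangentSpace I x)
    (x : M) (u : TangentSpace I x) :
    covDerivEnd cov φ Y x u = cov (fun y ↦ φ y (Y y)) x u - φ x (cov Y x u) := rfl

namespace NondegenerateMetric.IsLeviCivita

variable {h : NondegenerateMetric I M} {cov : CovariantDerivative I E (TangentSpace I : M → Type _)}
  {φ : Π x : M, TangentSpace I x →L[ℝ] TangentSpace I x} {X Y Z : Π x : M, TangentSpace I x}

theorem nijenhuis_eq (hcov : h.IsLeviCivita cov) (hφ : IsSmoothEndField φ)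
    (hX : CMDiff ∞ (T% X)) (hY : CMDiff ∞ (T% Y)) (x : M) :
    nijenhuis φ X Y x = covDerivEnd cov φ Y x (φ x (X x)) - covDerivEnd cov φ X x (φ x (Y x))
      + φ x (covDerivEnd cov φ X x (Y x)) - φ x (covDerivEnd cov φ Y x (X x)) := by
  have dX := hX.mdifferentiable (by simp) x
  have dY := hY.mdifferentiable (by simp) x
  have dφX := (hφ.contMDiff_apply hX).mdifferentiable (by simp) x
  have dφY := (hφ.contMDiff_apply hY).mdifferentiable (by simp) x
  rw [nijenhuis, ← hcov.torsion_free dX dY, ← hcov.torsion_free dφX dφY,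
    ← hcov.torsion_free dφX dY, ← hcov.torsion_free dX dφY]
  simp only [covDerivEnd_apply, map_sub]
  abel

theorem extDerivTwo_fundamentalForm_eq (hcov : h.IsLeviCivita cov) (hφ : IsSmoothEndField φ)
    (hskew : ∀ x v w, h x (φ x v) w = -h x v (φ x w))
    (hX : CMDiff ∞ (T% X)) (hY : CMDiff ∞ (T% Y)) (hZ : CMDiff ∞ (T% Z)) (x : M) :
    extDerivTwo (fundamentalForm h φ) X Y Z x = h x (covDerivEnd cov φ Y x (X x)) (Z x)
      + h x (covDerivEnd cov φ Z x (Y x)) (X x) + h x (covDerivEnd cov φ X x (Z x)) (Y x) := by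
  have dX := hX.mdifferentiable (by simp) x
  have dY := hY.mdifferentiable (by simp) x
  have dZ := hZ.mdifferentiable (by simp) x
  have dφX := (hφ.contMDiff_apply hX).mdifferentiable (by simp) x
  have dφY := (hφ.contMDiff_apply hY).mdifferentiable (by simp) x
  have e (V W : Π x : M, TangentSpace I x) :
      (fun y ↦ fundamentalForm h φ y (V y) (W y)) = fun y ↦ h y (φ y (V y)) (W y) := rfl
  have e' (v w : TangentSpace I x) : fundamentalForm h φ x v w = h x (φ x v) w := rfl
  have swap : (fun y ↦ h y (φ y (X y)) (Z y)) = -fun y ↦ h y (φ y (Z y)) (X y) := by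
    ext y
    simp [hskew y (X y), h.symm y (X y)]
  have dφZ := (hφ.contMDiff_apply hZ).mdifferentiable (by simp) x
  rw [extDerivTwo, e, e, e, swap, mvfderiv_neg, neg_apply, hcov.metric dφY dZ,
    hcov.metric dφZ dX, hcov.metric dφX dY, ← hcov.torsion_free dX dY, ← hcov.torsion_free dY dZ,
    ← hcov.torsion_free dX dZ]
  simp only [e', covDerivEnd_apply, map_sub, sub_apply, hskew x (cov _ x _)]
  rw [h.symm x (φ x (Y x)), h.symm x (φ x (Z x)), h.symm x (φ x (X x))]
  ring

end NondegenerateMetric.IsLeviCivita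

theorem isSmoothEndField_id :
    IsSmoothEndField (I := I) (M := M) fun x ↦ ContinuousLinearMap.id ℝ (TangentSpace I x) := by
  intro x
  rw [contMDiffAt_hom_bundle]
  refine ⟨contMDiffAt_id, ?_⟩
  refine (contMDiffAt_const (c := ContinuousLinearMap.id ℝ E)).congr_of_eventuallyEq ?_
  filter_upwards [(trivializationAt E (TangentSpace I) x).open_baseSet.mem_nhds
    (FiberBundle.mem_baseSet_trivializationAt' x)] with y hy
  rw [ContinuousLinearMap.inCoordinates_eq hy hy]
  ext v
  simp

namespace IsAlmostParaHermitian

variable {h : NondegenerateMetric I M} {P : Π x : M, TangentSpace I x →L[ℝ] TangentSpace I x}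

theorem skew (hP : IsAlmostParaHermitian h P) (x : M) (v w : TangentSpace I x) :
    h x (P x v) w = -h x v (P x w) := by
  rw [hP.hyperbolic]
  simp [conjProduct]

theorem covDerivEnd_comp (hP : IsAlmostParaHermitian h P)
    (cov : CovariantDerivative I E (TangentSpace I : M → Type _)) (Y : Π x : M, TangentSpace I x)
    (x : M) (u : TangentSpace I x) :
    covDerivEnd cov P (fun y ↦ P y (Y y)) x u = -P x (covDerivEnd cov P Y x u) := by
  simp only [covDerivEnd_apply, hP.sq, map_sub]
  abel

theorem covDerivEnd_skew (hP : IsAlmostParaHermitian h P)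
    {cov : CovariantDerivative I E (TangentSpace I : M → Type _)} (hcov : h.IsLeviCivita cov)
    {Y Z : Π x : M, TangentSpace I x} (hY : CMDiff ∞ (T% Y)) (hZ : CMDiff ∞ (T% Z))
    (x : M) (u : TangentSpace I x) :
    h x (covDerivEnd cov P Y x u) (Z x) = -h x (covDerivEnd cov P Z x u) (Y x) := by
  have dY := hY.mdifferentiable (by simp) x
  have dZ := hZ.mdifferentiable (by simp) x
  have dPY := (hP.smooth.contMDiff_apply hY).mdifferentiable (by simp) x
  have dPZ := (hP.smooth.contMDiff_apply hZ).mdifferentiable (by simp) x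
  have swap : (fun y ↦ h y (P y (Y y)) (Z y)) = -fun y ↦ h y (P y (Z y)) (Y y) := by
    ext y
    simp [hP.skew y (Y y), h.symm y (Y y)]
  have h1 := hcov.metric (X := FiberBundle.extend E u) dPY dZ
  have h2 := hcov.metric (X := FiberBundle.extend E u) dPZ dY
  rw [swap, mvfderiv_neg, neg_apply, h2] at h1
  simp only [FiberBundle.extend_apply_self] at h1
  simp only [covDerivEnd_apply, map_sub, sub_apply, hP.skew x (cov _ x _)]
  rw [h.symm x (P x (Y x)), h.symm x (P x (Z x))] at h1
  linarith

end IsAlmostParaHermitian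

omit [IsManifold I ∞ M] in
theorem associatedProduct_apply (G : Π x : M, TangentSpace I x →L[ℝ] TangentSpace I x) (x : M)
    (v : TangentSpace I x) :
    associatedProduct G x v = (1 / √5 : ℝ) • ((2 : ℝ) • G x v - v) := rfl

theorem IsAlmostGoldenHermitian.associatedProduct {h : NondegenerateMetric I M}
    {G : Π x : M, TangentSpace I x →L[ℝ] TangentSpace I x} (hG : IsAlmostGoldenHermitian h G) :
    IsAlmostParaHermitian h (associatedProduct G) where
  smooth := (((ContMDiff.const_smul_section (a := (2 : ℝ)) hG.smooth).sub_section
    isSmoothEndField_id).const_smul_section :)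
  sq x v := by
    have h5 : (1 / √5 : ℝ) * (1 / √5) * 5 = 1 := by
      have : √5 * √5 = (5 : ℝ) := Real.mul_self_sqrt (by norm_num)
      field_simp
      linarith
    simp only [associatedProduct_apply, map_smul, map_sub, hG.sq]
    calc (1 / √5 : ℝ) • ((2 : ℝ) • (1 / √5 : ℝ) • ((2 : ℝ) • (G x v + v) - G x v) -
        (1 / √5 : ℝ) • ((2 : ℝ) • G x v - v))
        = ((1 / √5 : ℝ) * (1 / √5) * 5) • v := by module
      _ = v := by rw [h5, one_smul]
  hyperbolic x v w := by
    simp only [conjProduct, associatedProduct_apply, neg_apply, map_smul, map_sub, map_neg,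
      smul_apply, sub_apply, hG.hyperbolic, conjGolden, smul_eq_mul]
    simp
    ring

theorem covDerivEnd_associatedProduct
    {G : Π x : M, TangentSpace I x →L[ℝ] TangentSpace I x}
    (cov : CovariantDerivative I E (TangentSpace I : M → Type _)) (hG : IsSmoothEndField G)
    {Y : Π x : M, TangentSpace I x} (hY : CMDiff ∞ (T% Y)) (x : M) :
    covDerivEnd cov (associatedProduct G) Y x = (2 / √5 : ℝ) • covDerivEnd cov G Y x := by
  have dY := hY.mdifferentiable (by simp) x
  have dGY := (hG.contMDiff_apply hY).mdifferentiable (by simp) x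
  have e : (fun y ↦ associatedProduct G y (Y y)) =
      (2 / √5 : ℝ) • (fun y ↦ G y (Y y)) + (-(1 / √5) : ℝ) • Y := by
    ext y
    simp only [associatedProduct_apply, Pi.add_apply, Pi.smul_apply]
    module
  ext u
  rw [covDerivEnd_apply, e, cov.isCovariantDerivativeOn.add
    (MDifferentiableAt.smul_const_section dGY) (MDifferentiableAt.smul_const_section dY),
    cov.isCovariantDerivativeOn.smul_const _ dGY,
    cov.isCovariantDerivativeOn.smul_const _ dY]
  simp only [associatedProduct_apply, covDerivEnd_apply, add_apply, smul_apply]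
  module

theorem isParallel_associatedProduct_iff
    {G : Π x : M, TangentSpace I x →L[ℝ] TangentSpace I x}
    (cov : CovariantDerivative I E (TangentSpace I : M → Type _)) (hG : IsSmoothEndField G) :
    IsParallel cov (associatedProduct G) ↔ IsParallel cov G := by
  refine forall₄_congr fun X Y hX hY ↦ forall_congr' fun x ↦ ?_
  simp only [← covDerivEnd_apply, covDerivEnd_associatedProduct cov hG hY]
  simp

variable [FiniteDimensional ℝ E]

/-- Every tangent vector is the value of a globally smooth vector field. -/
theorem exists_contMDiff_vectorField_eq [T2Space M] (x : M) (v : TangentSpace I x) :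
    ∃ X : Π y : M, TangentSpace I y, CMDiff ∞ (T% X) ∧ X x = v := by
  obtain ⟨s, hs, hσ⟩ := FiberBundle.exists_contMDiffOn_extend (k := ∞) I E v
  obtain ⟨u, hus, hu, hxu⟩ := mem_nhds_iff.1 hs
  obtain ⟨f, hf⟩ :=
    (SmoothBumpFunction.nhds_basis_support (I := I) (hu.mem_nhds hxu)).ex_mem
  refine ⟨(f : M → ℝ) • FiberBundle.extend E v,
    ContMDiffOn.smul_section_of_tsupport f.contMDiff.contMDiffOn hu hf (hσ.mono hus), ?_⟩
  simp

namespace IsAlmostParaHermitian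

variable {h : NondegenerateMetric I M} {P : Π x : M, TangentSpace I x →L[ℝ] TangentSpace I x}

theorem isParallel_iff [T2Space M] (hP : IsAlmostParaHermitian h P)
    {cov : CovariantDerivative I E (TangentSpace I : M → Type _)} (hcov : h.IsLeviCivita cov) :
    IsParallel cov P ↔ IsParaKaehler h P := by
  refine ⟨fun hpar ↦ ⟨hP, fun X Y Z hX hY hZ x ↦ ?_, fun X Y hX hY x ↦ ?_⟩, fun hK ↦ ?_⟩
  · rw [hcov.extDerivTwo_fundamentalForm_eq hP.smooth hP.skew hX hY hZ]
    simp only [covDerivEnd_apply, hpar X Y hX hY, hpar Y Z hY hZ, hpar Z X hZ hX]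
    simp
  · rw [hcov.nijenhuis_eq hP.smooth hX hY]
    simp only [covDerivEnd_apply, hpar X Y hX hY, hpar Y X hY hX,
      hpar _ Y (hP.smooth.contMDiff_apply hX) hY, hpar _ X (hP.smooth.contMDiff_apply hY) hX]
    simp
  · have key {X Y Z : Π x : M, TangentSpace I x} (hX : CMDiff ∞ (T% X)) (hY : CMDiff ∞ (T% Y))
        (hZ : CMDiff ∞ (T% Z)) (x : M) :
        h x (P x (covDerivEnd cov P Y x (X x))) (Z x) = 0 := by
      have hPY := hP.smooth.contMDiff_apply hY
      have hPZ := hP.smooth.contMDiff_apply hZ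
      have h1 := hK.closed _ _ _ hX hPY hZ x
      have h2 := hK.closed _ _ _ hX hY hPZ x
      have h3 := congr(h x $(hK.integrable _ _ hY hZ x) (X x))
      rw [hcov.extDerivTwo_fundamentalForm_eq hP.smooth hP.skew hX hPY hZ] at h1
      rw [hcov.extDerivTwo_fundamentalForm_eq hP.smooth hP.skew hX hY hPZ] at h2
      rw [hcov.nijenhuis_eq hP.smooth hY hZ] at h3
      have h4 := hP.covDerivEnd_skew hcov hX hPY x (Z x)
      have h5 := hP.covDerivEnd_skew hcov hX hY x (P x (Z x))
      simp only [hP.covDerivEnd_comp, map_add, map_sub, map_neg, map_zero, add_apply, sub_apply,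
        neg_apply, zero_apply] at h1 h2 h3 h4
      have h6 := hP.skew x (covDerivEnd cov P Y x (X x)) (Z x)
      linarith
    intro X Y hX hY x
    rw [← covDerivEnd_apply]
    refine h.nondegenerate x _ fun w ↦ ?_
    obtain ⟨Z, hZ, rfl⟩ := exists_contMDiff_vectorField_eq x w
    have := key hX hY (hP.smooth.contMDiff_apply hZ) x
    rw [hP.skew, hP.sq] at this
    linarith

end IsAlmostParaHermitian

section Golden

variable {h : NondegenerateMetric I M} {G : Π x : M, TangentSpace I x →L[ℝ] TangentSpace I x}

theorem IsAlmostGoldenHermitian.isIntegrable_associatedProduct_iff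
    (hG : IsAlmostGoldenHermitian h G) :
    IsIntegrable (_root_.associatedProduct G) ↔ IsIntegrable G := by
  refine forall₄_congr fun X Y hX hY ↦ forall_congr' fun x ↦ ?_
  have hcov := h.isLeviCivita_leviCivita
  have : nijenhuis (_root_.associatedProduct G) X Y x = (4 / (√5 * √5) : ℝ) • nijenhuis G X Y x := by
    rw [hcov.nijenhuis_eq hG.smooth hX hY, hcov.nijenhuis_eq hG.associatedProduct.smooth hX hY]
    simp only [covDerivEnd_associatedProduct _ hG.smooth hX,
      covDerivEnd_associatedProduct _ hG.smooth hY, associatedProduct_apply, map_smul, map_sub,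
      smul_apply]
    module
  rw [this]
  simp

theorem IsAlmostGoldenHermitian.isParallel_iff [T2Space M] (hG : IsAlmostGoldenHermitian h G) :
    IsParallel h.leviCivita G ↔ IsGoldenKaehler h G := by
  rw [← isParallel_associatedProduct_iff _ hG.smooth,
    hG.associatedProduct.isParallel_iff h.isLeviCivita_leviCivita]
  exact ⟨fun hK ↦ ⟨hG, hK.closed, hG.isIntegrable_associatedProduct_iff.1 hK.integrable⟩,
    fun hK ↦ ⟨hG.associatedProduct, hK.closed,
      hG.isIntegrable_associatedProduct_iff.2 hK.integrable⟩⟩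

end Golden

end ParallelStructures

theorem mainTheorem9
    {E : Type*} [NormedAddCommGroup E] [NormedSpace ℝ E] [FiniteDimensional ℝ E]
    {H : Type*} [TopologicalSpace H] {I : ModelWithCorners ℝ E H}
    {M : Type*} [TopologicalSpace M] [ChartedSpace H M] [IsManifold I ∞ M]
    [BoundarylessManifold I M] [T2Space M] [SecondCountableTopology M]
    (h : NondegenerateMetric I M) :
    (∀ P : (x : M) → TangentSpace I x →L[ℝ] TangentSpace I x, IsAlmostParaHermitian h P →
      (IsParallel h.leviCivita P ↔ IsParaKaehler h P)) ∧
    (∀ G : (x : M) → TangentSpace I x →L[ℝ] TangentSpace I x, IsAlmostGoldenHermitian h G →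
      (IsParallel h.leviCivita G ↔ IsGoldenKaehler h G)) :=
  ⟨fun _ hP ↦ hP.isParallel_iff h.isLeviCivita_leviCivita, fun _ hG ↦ hG.isParallel_iff⟩
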